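/- Let $\Omega\subset\mathbb R^2$ be a bounded $C^1$ domain, that is, a nonempty bounded connected open set such that near each boundary point, in suitable Cartesian coordinates, $\Omega$ is the part of a ball lying strictly above the graph of a $C^1$ function. Let $\bar\rho\in\mathbb R$. Then there exists a constant $C>0$, depending only on $\bar\rho$ and $\Omega$, such that for every $m\in\mathbb N$, every $\rho\in L^\infty(\Omega)$ with $0\le\rho\le\bar\rho$ a.e. in $\Omega$, and every $u\in H^1(\Omega;\mathbb R^m)$, one has $\sqrt\rho\,u\in L^4(\Omega;\mathbb R^m)$ and $$\|\sqrt{\rho}\,u\|_{L^4(\Omega)}^2\le C\left(1+\|\sqrt{\rho}\,u\|_{L^2(\Omega)}\right)\|u\|_{H^1(\Omega)}\,\log^{1/2}\!\left(2+\|u\|_{H^1(\Omega)}^2\right),$$ where $\|u\|_{H^1(\Omega)}^2=\|u\|_{L^2(\Omega)}^2+\|\nabla u\|_{L^2(\Omega)}^2$ and vectors and matrices carry their Euclidean norms. -/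

import Mathlib

open MeasureTheory Set
open scoped ENNReal ContDiff

/-- The plane, with its Euclidean norm. -/
abbrev Plane : Type := EuclideanSpace ℝ (Fin 2)

/-- The boundary of `Ω` is of class `C¹`: near each boundary point, after a linear isometric change
of the Cartesian coordinates, `Ω` is the part of a ball that lies strictly above the graph of a `C¹`
function. -/
def HasC1Boundary (Ω : Set Plane) : Prop :=
  ∀ x₀ ∈ frontier Ω, ∃ r : ℝ, 0 < r ∧ ∃ (e : Plane ≃ₗᵢ[ℝ] Plane) (γ : ℝ → ℝ),
    ContDiff ℝ 1 γ ∧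
      Ω ∩ Metric.ball x₀ r = {x | x ∈ Metric.ball x₀ r ∧ γ (e x 0) < e x 1}

/-- A bounded `C¹` domain in the plane. -/
structure IsBoundedC1Domain (Ω : Set Plane) : Prop where
  isOpen : IsOpen Ω
  isConnected : IsConnected Ω
  isBounded : Bornology.IsBounded Ω
  c1Boundary : HasC1Boundary Ω

/-- `v` is a weak `j`-th partial derivative of `u` on the open set `Ω`: both are locally integrable
on `Ω`, and `∫_Ω u ∂ⱼφ = - ∫_Ω v φ` for every test function `φ ∈ C_c^∞(Ω)`. Values outside `Ω`
play no role. -/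
def IsWeakPartialDeriv {m : ℕ} (Ω : Set Plane) (j : Fin 2)
    (u v : Plane → EuclideanSpace ℝ (Fin m)) : Prop :=
  LocallyIntegrableOn u Ω ∧ LocallyIntegrableOn v Ω ∧
    ∀ φ : Plane → ℝ, ContDiff ℝ ∞ φ → HasCompactSupport φ → tsupport φ ⊆ Ω →
      ∫ x in Ω, (fderiv ℝ φ x (EuclideanSpace.single j 1)) • u x = -∫ x in Ω, φ x • v x

/-- `u ∈ H¹(Ω; ℝᵐ)`: `u` is in `L²(Ω)` and has both weak partial derivatives in `L²(Ω)`. -/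
def MemH1 {m : ℕ} (Ω : Set Plane) (u : Plane → EuclideanSpace ℝ (Fin m)) : Prop :=
  MemLp u 2 (volume.restrict Ω) ∧
    ∀ j : Fin 2, ∃ v : Plane → EuclideanSpace ℝ (Fin m),
      MemLp v 2 (volume.restrict Ω) ∧ IsWeakPartialDeriv Ω j u v

open Classical in
/-- The weak `j`-th partial derivative of `u` on `Ω` in `L²(Ω)` (unique up to null sets), and `0`
if there is none. -/
noncomputable def weakPartial {m : ℕ} (Ω : Set Plane) (j : Fin 2)
    (u : Plane → EuclideanSpace ℝ (Fin m)) : Plane → EuclideanSpace ℝ (Fin m) :=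
  if h : ∃ v : Plane → EuclideanSpace ℝ (Fin m),
      MemLp v 2 (volume.restrict Ω) ∧ IsWeakPartialDeriv Ω j u v
  then h.choose else 0

theorem MemH1.weakPartial_spec {m : ℕ} {Ω : Set Plane} {u : Plane → EuclideanSpace ℝ (Fin m)}
    (hu : MemH1 Ω u) (j : Fin 2) :
    MemLp (weakPartial Ω j u) 2 (volume.restrict Ω) ∧
      IsWeakPartialDeriv Ω j u (weakPartial Ω j u) := by
  have h := hu.2 j
  rw [weakPartial, dif_pos h]
  exact h.choose_spec

/-- The norm of `L^p(Ω; ℝᵐ)` as a real number (meaningful for `MemLp f p (volume.restrict Ω)`). -/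
noncomputable def normLp {m : ℕ} (Ω : Set Plane) (p : ℝ≥0∞)
    (f : Plane → EuclideanSpace ℝ (Fin m)) : ℝ :=
  (eLpNorm f p (volume.restrict Ω)).toReal

/-- The norm `(‖u‖²_{L²(Ω)} + ∑ⱼ ‖∂ⱼu‖²_{L²(Ω)})^{1/2}` of `H¹(Ω; ℝᵐ)`. -/
noncomputable def normH1 {m : ℕ} (Ω : Set Plane) (u : Plane → EuclideanSpace ℝ (Fin m)) : ℝ :=
  Real.sqrt (normLp Ω 2 u ^ 2 + ∑ j : Fin 2, normLp Ω 2 (weakPartial Ω j u) ^ 2)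

/-!
The heart of the matter is the sharp growth of the two-dimensional Sobolev embedding:
`‖u‖_{L^{2n}(Ω)} ≤ A √n ‖u‖_{H¹(Ω)}` with `A` independent of `n` and of the number of components
of `u` (`IsBoundedC1Domain.exists_lintegral_pow_le`, where it is raised to the power `2n`).
Interpolating `L⁴` between `L²` and `L^{2q+2}` gives
`‖g‖₄^{4q} ≤ ‖g‖₂^{2(q-1)} ‖g‖_{2q+2}^{2q+2}` for `g = √ρ u`, and the choice
`q = ⌈log (2 + ‖u‖²_{H¹})⌉`, for which `‖u‖_{H¹}^{2/q}` is bounded, turns the growth `√q` into the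
factor `log^{1/2}` (`sq_le_of_pow_ceil_log_le`).

The embedding is proved directly on `Ω`, with no extension operator. A `C¹` graph is locally
Lipschitz, so `Ω` is covered by finitely many open `V`, each with a fixed ball `B` such that
`x + t w ∈ Ω` for all `x ∈ V`, `w ∈ B`, `t ∈ [0, 1]`
(`IsBoundedC1Domain.exists_finite_cover`). For `w ∈ B` the identity
`u(x) = u(x + w) - ∫₀¹ ∂_w u(x + t w) dt` holds for almost every `x ∈ V`: it is tested against
`φ ∈ C_c^∞(V)`, whose translates `φ(· - t w)` are admissible in the definition of the weak
derivative (`ae_eq_sub_integral_of_weak_deriv`). Averaging over `w ∈ B` and substituting `y = t w`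
bounds `|u|` on `V` by the convolution of `|u| + |∇u|` with the truncated Riesz kernel
`|y|⁻¹ 1_{|y| < R}` (`measure_ball_mul_le_lintegral_rieszKernel`). Young's inequality for this
kernel (`lintegral_pow_rieszKernel_le`) gives the growth in `n`, because the integral of
`|y|^{-2n/(n+1)}` over a disc is of order `n + 1`.
-/

/-! ### Young's inequality for the truncated Riesz kernel -/

/-- Hölder's inequality behind Young's: `κ^{(n+1)/2n} G` is the product of `κ G²`, `G²` and `κ` to
the powers `1/2n`, `(n-1)/2n` and `1/2`, which add up to `1`. -/
theorem lintegral_mul_pow_le {α : Type*} [MeasurableSpace α] {μ : Measure α} {κ G : α → ℝ≥0∞}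
    (hκ : Measurable κ) (hG : Measurable G) {n : ℕ} (hn : 1 ≤ n) :
    (∫⁻ y, κ y ^ (((n : ℝ) + 1) / (2 * n)) * G y ∂μ) ^ (2 * n) ≤
      (∫⁻ y, κ y * G y ^ 2 ∂μ) * (∫⁻ y, G y ^ 2 ∂μ) ^ (n - 1) * (∫⁻ y, κ y ∂μ) ^ n := by
  have hn0 : (0 : ℝ) < n := by exact_mod_cast hn
  have hn1 : (1 : ℝ) ≤ n := by exact_mod_cast hn
  have ha : (0 : ℝ) ≤ 1 / (2 * n) := by positivity
  have hb : (0 : ℝ) ≤ (n - 1) / (2 * n) := div_nonneg (by linarith) (by positivity)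
  have hc : (0 : ℝ) ≤ n / (2 * n) := by positivity
  have key := ENNReal.lintegral_prod_norm_pow_le (μ := μ) (Finset.univ : Finset (Fin 3))
    (f := ![fun y => κ y * G y ^ 2, fun y => G y ^ 2, κ])
    (p := ![1 / (2 * n), (n - 1) / (2 * n), n / (2 * n)])
    (by
      intro i _
      fin_cases i
      · exact (hκ.mul (hG.pow_const 2)).aemeasurable
      · exact (hG.pow_const 2).aemeasurable
      · exact hκ.aemeasurable)
    (by simp [Fin.sum_univ_three]; field_simp; ring)
    (by
      intro i _
      fin_cases i
      · exact ha
      · exact hb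
      · exact hc)
  simp only [Fin.prod_univ_three, Matrix.cons_val_zero, Matrix.cons_val_one, Matrix.cons_val] at key
  have hint : ∀ y, (κ y * G y ^ 2) ^ (1 / (2 * n : ℝ)) * (G y ^ 2) ^ (((n : ℝ) - 1) / (2 * n)) *
      κ y ^ ((n : ℝ) / (2 * n)) = κ y ^ (((n : ℝ) + 1) / (2 * n)) * G y := by
    intro y
    have h2 : ∀ s : ℝ, (G y ^ 2) ^ s = G y ^ (2 * s) := fun s => by
      rw [← ENNReal.rpow_natCast, ← ENNReal.rpow_mul]; norm_num
    rw [ENNReal.mul_rpow_of_nonneg _ _ ha, h2, h2]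
    calc _ = (κ y ^ (1 / (2 * n : ℝ)) * κ y ^ ((n : ℝ) / (2 * n))) *
          (G y ^ (2 * (1 / (2 * n : ℝ))) * G y ^ (2 * (((n : ℝ) - 1) / (2 * n)))) := by ring
      _ = _ := by
        rw [← ENNReal.rpow_add_of_nonneg _ _ ha hc,
          ← ENNReal.rpow_add_of_nonneg _ _ (by positivity) (by positivity)]
        congr 1
        · congr 1; field_simp; ring
        · rw [← ENNReal.rpow_one (G y), ← ENNReal.rpow_mul]; congr 1; field_simp; ring
  simp only [hint] at key
  have hp : ∀ (z : ℝ≥0∞) (s : ℝ), (z ^ s) ^ (2 * n) = z ^ (s * (2 * n)) := fun z s => by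
    rw [← ENNReal.rpow_natCast, ← ENNReal.rpow_mul]; push_cast; rfl
  calc _ ≤ _ := pow_le_pow_left' key (2 * n)
    _ = _ := by
      rw [mul_pow, mul_pow, hp, hp, hp]
      congr 1
      · congr 1
        · rw [div_mul_cancel₀ _ (by positivity), ENNReal.rpow_one]
        · rw [div_mul_cancel₀ _ (by positivity), ← ENNReal.rpow_natCast, Nat.cast_sub hn]
          simp
      · rw [div_mul_cancel₀ _ (by positivity), ENNReal.rpow_natCast]

/-- Young's inequality `L^r ∗ L² ⊆ L^{2n}`, `r = 2n/(n+1)`, for the kernel `κ^{1/r}`. -/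
theorem lintegral_pow_lintegral_mul_add_le {κ G : Plane → ℝ≥0∞}
    (hκ : Measurable κ) (hG : Measurable G) {n : ℕ} (hn : 1 ≤ n) :
    ∫⁻ x, (∫⁻ y, κ y ^ (((n : ℝ) + 1) / (2 * n)) * G (x + y)) ^ (2 * n) ≤
      (∫⁻ y, κ y) ^ (n + 1) * (∫⁻ y, G y ^ 2) ^ n := by
  have hG2 : ∀ x, ∫⁻ y, G (x + y) ^ 2 = ∫⁻ y, G y ^ 2 := fun x =>
    lintegral_add_left_eq_self (fun y => G y ^ 2) x
  have hm : Measurable (Function.uncurry fun x y : Plane => κ y * G (x + y) ^ 2) :=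
    (hκ.comp measurable_snd).mul ((hG.comp (measurable_fst.add measurable_snd)).pow_const 2)
  calc _ ≤ ∫⁻ x, (∫⁻ y, κ y * G (x + y) ^ 2) *
        ((∫⁻ y, G y ^ 2) ^ (n - 1) * (∫⁻ y, κ y) ^ n) := by
        refine lintegral_mono fun x => ?_
        refine (lintegral_mul_pow_le hκ (hG.comp (measurable_const_add x)) hn).trans ?_
        rw [Function.comp_def, hG2, mul_assoc]
    _ = (∫⁻ y, ∫⁻ x, κ y * G (x + y) ^ 2) *
        ((∫⁻ y, G y ^ 2) ^ (n - 1) * (∫⁻ y, κ y) ^ n) := by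
        rw [lintegral_lintegral_swap (f := fun y x => κ y * G (x + y) ^ 2)
          (hm.comp measurable_swap).aemeasurable]
        exact lintegral_mul_const _ hm.lintegral_prod_right'
    _ = ((∫⁻ y, κ y) * ∫⁻ x, G x ^ 2) * ((∫⁻ y, G y ^ 2) ^ (n - 1) * (∫⁻ y, κ y) ^ n) := by
        congr 1
        rw [← lintegral_mul_const _ hκ]
        refine lintegral_congr fun y => ?_
        rw [← lintegral_add_right_eq_self (fun x => G x ^ 2) y]
        exact lintegral_const_mul _ ((hG.comp (measurable_add_const y)).pow_const 2)
    _ = _ := by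
        obtain ⟨k, rfl⟩ := Nat.exists_eq_add_of_le' hn
        simp only [Nat.add_sub_cancel]
        ring

/-- The kernel `|y|⁻¹` of the plane, cut off at radius `R`. Its value at `0` is `∞`, on a null
set. -/
noncomputable def rieszKernel (R : ℝ) : Plane → ℝ≥0∞ :=
  (Metric.ball (0 : Plane) R).indicator fun y => ‖y‖ₑ⁻¹

theorem measurable_rieszKernel (R : ℝ) : Measurable (rieszKernel R) :=
  measurable_enorm.inv.indicator measurableSet_ball

/-- As `s` tends to `2`, the integral of the `s`-th power of the kernel blows up only like
`(2 - s)⁻¹`; this fixes the growth of the Sobolev constant in the exponent. -/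
theorem lintegral_rieszKernel_rpow_le {R : ℝ} (hR : 1 ≤ R) {s : ℝ} (hs1 : 1 ≤ s)
    (hs2 : s < 2) :
    ∫⁻ y, rieszKernel R y ^ s ≤
      ENNReal.ofReal (2 * R * volume.real (Metric.ball (0 : Plane) 1) / (2 - s)) := by
  have hR0 : 0 < R := by linarith
  have hs : 0 < s := by linarith
  set f : ℝ → ℝ := (Iio R).indicator fun t => t ^ (-s) with hf
  have hfi : IntegrableOn (fun t : ℝ => t ^ (1 - s)) (Ioc 0 R) :=
    (intervalIntegrable_iff_integrableOn_Ioc_of_le hR0.le).1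
      (intervalIntegral.intervalIntegrable_rpow' (by linarith))
  have hfeq : ∀ t ∈ Ioi (0 : ℝ), t ^ (2 - 1) • f t =
      (Ioo 0 R).indicator (fun t : ℝ => t ^ (1 - s)) t := by
    intro t ht
    have ht : 0 < t := ht
    by_cases h : t < R
    · rw [hf, indicator_of_mem (show t ∈ Iio R from h),
        indicator_of_mem (show t ∈ Ioo 0 R from ⟨ht, h⟩)]
      simp only [Nat.add_one_sub_one, pow_one, smul_eq_mul]
      rw [Real.rpow_sub ht, Real.rpow_neg ht.le, Real.rpow_one]; rfl
    · rw [hf, indicator_of_notMem (by simpa using h), indicator_of_notMem (by simp [h])]; simp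
  have hio : IntegrableOn (fun t : ℝ => t ^ (1 - s)) (Ioo 0 R) := hfi.mono_set Ioo_subset_Ioc_self
  have hint : Integrable (fun y : Plane => f ‖y‖) := by
    rw [integrable_fun_norm_addHaar volume]
    rw [finrank_euclideanSpace, Fintype.card_fin]
    refine IntegrableOn.congr_fun ?_ (fun t ht => (hfeq t ht).symm) measurableSet_Ioi
    exact (hio.integrable_indicator measurableSet_Ioo).integrableOn
  have hf0 : ∀ y : Plane, 0 ≤ f ‖y‖ := fun y =>
    indicator_apply_nonneg fun _ => Real.rpow_nonneg (norm_nonneg _) _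
  have hae : ∀ᵐ y : Plane, rieszKernel R y ^ s = ENNReal.ofReal (f ‖y‖) := by
    filter_upwards [Measure.ae_ne volume (0 : Plane)] with y hy
    have hy' : 0 < ‖y‖ := norm_pos_iff.2 hy
    by_cases h : ‖y‖ < R
    · rw [rieszKernel, indicator_of_mem (by simpa using h), hf,
        indicator_of_mem (show ‖y‖ ∈ Iio R from h),
        ← ofReal_norm, ← ENNReal.ofReal_inv_of_pos hy', ENNReal.ofReal_rpow_of_pos (by positivity),
        Real.inv_rpow hy'.le, Real.rpow_neg hy'.le]
    · rw [rieszKernel, indicator_of_notMem (by simpa using h), hf,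
        indicator_of_notMem (by simpa using h)]
      simp [hs]
  rw [lintegral_congr_ae hae, ← ofReal_integral_eq_lintegral_ofReal hint (ae_of_all _ hf0),
    integral_fun_norm_addHaar volume f]
  refine ENNReal.ofReal_le_ofReal ?_
  rw [finrank_euclideanSpace, Fintype.card_fin, setIntegral_congr_fun measurableSet_Ioi hfeq,
    setIntegral_indicator measurableSet_Ioo, inter_eq_self_of_subset_right Ioo_subset_Ioi_self,
    ← integral_Ioc_eq_integral_Ioo, ← intervalIntegral.integral_of_le hR0.le,
    integral_rpow (Or.inl (by linarith)), Real.zero_rpow (by linarith)]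
  have : R ^ (1 - s + 1) ≤ R := by
    calc R ^ (1 - s + 1) ≤ R ^ (1 : ℝ) := Real.rpow_le_rpow_of_exponent_le hR (by linarith)
      _ = R := Real.rpow_one R
  have h2 : 1 - s + 1 = 2 - s := by ring
  rw [h2] at this ⊢
  have h3 : 0 < 2 - s := by linarith
  set v := volume.real (Metric.ball (0 : Plane) 1) with hv
  have hvR : v * R ^ (2 - s) ≤ v * R := mul_le_mul_of_nonneg_left this measureReal_nonneg
  calc (2 : ℕ) • v • ((R ^ (2 - s) - 0) / (2 - s)) = 2 * (v * R ^ (2 - s)) / (2 - s) := by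
        simp only [nsmul_eq_mul, smul_eq_mul, Nat.cast_ofNat]; ring
    _ ≤ 2 * R * v / (2 - s) := div_le_div_of_nonneg_right (by linarith) h3.le

/-- Young's inequality from `L²` to `L^{2n}` for the truncated Riesz kernel, with an explicit
constant. -/
theorem lintegral_pow_rieszKernel_le {R : ℝ} (hR : 1 ≤ R) {G : Plane → ℝ≥0∞}
    (hG : Measurable G) {n : ℕ} (hn : 1 ≤ n) :
    ∫⁻ x, (∫⁻ y, rieszKernel R y * G (x + y)) ^ (2 * n) ≤
      ENNReal.ofReal (R * volume.real (Metric.ball (0 : Plane) 1) * (n + 1)) ^ (n + 1) *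
        (∫⁻ y, G y ^ 2) ^ n := by
  have hn1 : (1 : ℝ) ≤ n := by exact_mod_cast hn
  have hn0 : (0 : ℝ) < n := by linarith
  set s : ℝ := 2 * n / (n + 1) with hs
  have hs1 : 1 ≤ s := by rw [hs, le_div_iff₀ (by positivity)]; linarith
  have hs2 : s < 2 := by rw [hs, div_lt_iff₀ (by positivity)]; linarith
  have h2s : 2 - s = 2 / (n + 1) := by rw [hs]; field_simp; ring
  have hk : ∀ y, (rieszKernel R y ^ s) ^ (((n : ℝ) + 1) / (2 * n)) = rieszKernel R y := fun y => by
    rw [← ENNReal.rpow_mul, hs, div_mul_div_cancel₀ (by positivity), div_self (by positivity),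
      ENNReal.rpow_one]
  have h := lintegral_pow_lintegral_mul_add_le ((measurable_rieszKernel R).pow_const s) hG hn
  simp only [hk] at h
  refine h.trans ?_
  gcongr
  refine (lintegral_rieszKernel_rpow_le hR hs1 hs2).trans
    (ENNReal.ofReal_le_ofReal (le_of_eq ?_))
  rw [h2s]; field_simp

/-! ### Averages over segments are dominated by the Riesz kernel -/

theorem lintegral_comp_smul_plane (f : Plane → ℝ≥0∞) {t : ℝ} (ht : 0 < t) (hf : Measurable f) :
    ∫⁻ w, f (t • w) = ENNReal.ofReal (t ^ 2)⁻¹ * ∫⁻ y, f y := by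
  have h := Measure.map_addHaar_smul (volume : Measure Plane) ht.ne'
  rw [finrank_euclideanSpace, Fintype.card_fin, abs_of_pos (by positivity)] at h
  rw [← lintegral_map hf (measurable_const_smul t), h, lintegral_smul_measure, smul_eq_mul]

theorem lintegral_Ioc_inv_sq_le {a R : ℝ} (ha : 0 < a) (hR : 0 < R) :
    ∫⁻ t in Ioc (0 : ℝ) 1, (Ioi (a / R)).indicator (fun t => ENNReal.ofReal (t ^ 2)⁻¹) t ≤
      ENNReal.ofReal (R * a⁻¹) := by
  have haR : 0 < a / R := by positivity
  calc _ ≤ ∫⁻ t, (Ioi (a / R)).indicator (fun t => ENNReal.ofReal (t ^ 2)⁻¹) t :=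
        setLIntegral_le_lintegral _ _
    _ = ∫⁻ t in Ioi (a / R), ENNReal.ofReal (t ^ (-2 : ℝ)) := by
        rw [lintegral_indicator measurableSet_Ioi]
        refine setLIntegral_congr_fun measurableSet_Ioi fun t ht => ?_
        have ht : 0 < t := haR.trans ht
        simp only [Real.rpow_neg ht.le]
        norm_cast
    _ = ENNReal.ofReal (R * a⁻¹) := by
        rw [← ofReal_integral_eq_lintegral_ofReal
          (integrableOn_Ioi_rpow_of_lt (by norm_num) haR)
          ((ae_restrict_mem measurableSet_Ioi).mono fun t ht =>
            Real.rpow_nonneg (haR.trans ht).le _),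
          integral_Ioi_rpow_of_lt (by norm_num) haR]
        congr 1
        norm_num
        rw [Real.rpow_neg haR.le, Real.rpow_one]
        field_simp

/-- Averages of `g` over the segments `[x, x + w]`, `w` in a ball, are dominated by the Riesz
kernel: after the substitution `y = t w`, the weight of `y` is at most
`∫_{|y|/R}^∞ t⁻² dt = R |y|⁻¹`. -/
theorem lintegral_segments_le {g : Plane → ℝ≥0∞} (hg : Measurable g) {c : Plane} {σ R : ℝ}
    (hR : 0 < R) (hB : Metric.ball c σ ⊆ Metric.ball 0 R) (x : Plane) :
    ∫⁻ w in Metric.ball c σ, ∫⁻ t in Ioc (0 : ℝ) 1, g (x + t • w) ≤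
      ENNReal.ofReal R * ∫⁻ y, rieszKernel R y * g (x + y) := by
  -- `J t y` is the density of `y = t w` for fixed `t`, with the indicator of the ball of directions
  -- enlarged to that of `|w| < R`.
  set J : ℝ → Plane → ℝ≥0∞ := fun t y =>
    ((Ioc (0 : ℝ) 1 ×ˢ Metric.ball (0 : Plane) R) ∩ {p : ℝ × Plane | ‖p.2‖ / R < p.1}).indicator
      (fun p => ENNReal.ofReal (p.1 ^ 2)⁻¹) (t, y) with hJ
  have hJm : Measurable (Function.uncurry J) := by
    refine Measurable.indicator (by fun_prop) ?_
    exact (measurableSet_Ioc.prod measurableSet_ball).inter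
      (measurableSet_lt (by fun_prop) (by fun_prop))
  have hgx : Measurable fun y => g (x + y) := hg.comp (measurable_const_add x)
  have h1 : ∀ t ∈ Ioc (0 : ℝ) 1, ∫⁻ w in Metric.ball c σ, g (x + t • w) ≤
      ∫⁻ y, J t y * g (x + y) := by
    intro t ht
    have hle : ∀ w, (Metric.ball c σ).indicator (fun w => g (x + t • w)) w ≤
        (Metric.ball (0 : Plane) (t * R)).indicator (fun y => g (x + y)) (t • w) := by
      intro w
      by_cases hw : w ∈ Metric.ball c σ
      · have hw' := hB hw
        rw [mem_ball_zero_iff] at hw'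
        rw [indicator_of_mem hw, indicator_of_mem]
        rw [mem_ball_zero_iff, norm_smul, Real.norm_of_nonneg ht.1.le]
        exact mul_lt_mul_of_pos_left hw' ht.1
      · rw [indicator_of_notMem hw]; simp
    rw [← lintegral_indicator measurableSet_ball]
    refine (lintegral_mono hle).trans ?_
    rw [lintegral_comp_smul_plane _ ht.1 (hgx.indicator measurableSet_ball),
      ← lintegral_const_mul _ (hgx.indicator measurableSet_ball)]
    refine lintegral_mono fun y => ?_
    by_cases hy : y ∈ Metric.ball (0 : Plane) (t * R)
    · have hy' := hy
      rw [mem_ball_zero_iff] at hy'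
      have : (t, y) ∈ (Ioc (0 : ℝ) 1 ×ˢ Metric.ball (0 : Plane) R) ∩
          {p : ℝ × Plane | ‖p.2‖ / R < p.1} := by
        refine ⟨⟨ht, ?_⟩, ?_⟩
        · rw [mem_ball_zero_iff]
          exact hy'.trans_le (mul_le_of_le_one_left hR.le ht.2)
        · exact (div_lt_iff₀ hR).2 hy'
      simp only [hJ]
      rw [indicator_of_mem hy, indicator_of_mem this]
    · simp only [indicator_of_notMem hy, mul_zero, zero_le]
  have h2 : ∀ᵐ y : Plane, ∫⁻ t in Ioc (0 : ℝ) 1, J t y ≤ ENNReal.ofReal R * rieszKernel R y := by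
    filter_upwards [Measure.ae_ne volume (0 : Plane)] with y hy
    have hy0 : 0 < ‖y‖ := norm_pos_iff.2 hy
    by_cases h : y ∈ Metric.ball (0 : Plane) R
    · rw [rieszKernel, indicator_of_mem h, ← ofReal_norm, ← ENNReal.ofReal_inv_of_pos hy0,
        ← ENNReal.ofReal_mul hR.le]
      refine le_trans (lintegral_mono fun t => ?_) (lintegral_Ioc_inv_sq_le hy0 hR)
      by_cases ht : ‖y‖ / R < t
      · rw [indicator_of_mem (show t ∈ Ioi (‖y‖ / R) from ht)]
        exact indicator_le_self _ _ _
      · simp only [hJ]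
        rw [indicator_of_notMem fun h => ht h.2]
        exact zero_le
    · have : ∀ t, J t y = 0 := fun t => indicator_of_notMem (fun h' => h h'.1.2) _
      simp [this]
  have hm1 : Measurable fun p : Plane × ℝ => g (x + p.2 • p.1) :=
    hg.comp (by fun_prop)
  have hm2 : Measurable fun p : ℝ × Plane => J p.1 p.2 * g (x + p.2) :=
    hJm.mul (hgx.comp measurable_snd)
  calc _ = ∫⁻ t in Ioc (0 : ℝ) 1, ∫⁻ w in Metric.ball c σ, g (x + t • w) :=
        lintegral_lintegral_swap hm1.aemeasurable
    _ ≤ ∫⁻ t in Ioc (0 : ℝ) 1, ∫⁻ y, J t y * g (x + y) :=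
        setLIntegral_mono' measurableSet_Ioc h1
    _ = ∫⁻ y, ∫⁻ t in Ioc (0 : ℝ) 1, J t y * g (x + y) :=
        lintegral_lintegral_swap hm2.aemeasurable
    _ = ∫⁻ y, (∫⁻ t in Ioc (0 : ℝ) 1, J t y) * g (x + y) := by
        refine lintegral_congr fun y => lintegral_mul_const _ ?_
        exact hJm.comp (measurable_id.prodMk measurable_const)
    _ ≤ ∫⁻ y, ENNReal.ofReal R * (rieszKernel R y * g (x + y)) := by
        refine lintegral_mono_ae ?_
        filter_upwards [h2] with y hy
        rw [← mul_assoc]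
        gcongr
    _ = _ := lintegral_const_mul _ ((measurable_rieszKernel R).mul hgx)

theorem setLIntegral_ball_le {F : Plane → ℝ≥0∞} (hF : Measurable F) {c : Plane} {σ R : ℝ}
    (hR : 0 < R) (hB : Metric.ball c σ ⊆ Metric.ball 0 R) (x : Plane) :
    ∫⁻ w in Metric.ball c σ, F (x + w) ≤ ENNReal.ofReal R * ∫⁻ y, rieszKernel R y * F (x + y) := by
  have hFx : Measurable fun y => F (x + y) := hF.comp (measurable_const_add x)
  have hkF : Measurable fun y => rieszKernel R y * F (x + y) := (measurable_rieszKernel R).mul hFx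
  rw [← lintegral_indicator measurableSet_ball, ← lintegral_const_mul _ hkF]
  refine lintegral_mono fun w => ?_
  by_cases hw : w ∈ Metric.ball c σ
  · rw [indicator_of_mem hw, rieszKernel, indicator_of_mem (hB hw), ← mul_assoc]
    refine le_mul_of_one_le_left zero_le ?_
    have hw' := hB hw
    rw [mem_ball_zero_iff] at hw'
    rw [← div_eq_mul_inv, ENNReal.le_div_iff_mul_le (Or.inr (by simp [hR])) (Or.inl enorm_ne_top),
      one_mul, ← ofReal_norm]
    exact ENNReal.ofReal_le_ofReal hw'.le
  · simp [indicator_of_notMem hw]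

/-- If `F` grows along each translation `w` of a ball by at most the integral of `R g` over the
segment, then averaging over the ball gives a pointwise bound of `F` by a Riesz potential of
`F + g`. -/
theorem measure_ball_mul_le_lintegral_rieszKernel {F g : Plane → ℝ≥0∞} (hF : Measurable F)
    (hg : Measurable g) {V : Set Plane} (hV : MeasurableSet V) {c : Plane} {σ R : ℝ} (hR : 1 ≤ R)
    (hB : Metric.ball c σ ⊆ Metric.ball 0 R)
    (h : ∀ w ∈ Metric.ball c σ, ∀ᵐ x, x ∈ V →
      F x ≤ F (x + w) + ENNReal.ofReal R * ∫⁻ t in Ioc (0 : ℝ) 1, g (x + t • w)) :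
    ∀ᵐ x, x ∈ V → volume (Metric.ball c σ) * F x ≤
      ENNReal.ofReal (R ^ 2) * ∫⁻ y, rieszKernel R y * (F (x + y) + g (x + y)) := by
  have hR0 : 0 < R := by linarith
  have hm : Measurable fun p : Plane × Plane => ∫⁻ t in Ioc (0 : ℝ) 1, g (p.2 + t • p.1) :=
    Measurable.lintegral_prod_right' (f := fun q : (Plane × Plane) × ℝ => g (q.1.2 + q.2 • q.1.1))
      (hg.comp (by fun_prop))
  have hset : MeasurableSet {p : Plane × Plane | p.1 ∈ Metric.ball c σ → p.2 ∈ V →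
      F p.2 ≤ F (p.2 + p.1) + ENNReal.ofReal R * ∫⁻ t in Ioc (0 : ℝ) 1, g (p.2 + t • p.1)} := by
    refine MeasurableSet.imp (measurable_fst measurableSet_ball)
      (MeasurableSet.imp (measurable_snd hV) (measurableSet_le (hF.comp measurable_snd) ?_))
    exact (hF.comp (by fun_prop)).add (hm.const_mul _)
  have hae : ∀ᵐ w : Plane, ∀ᵐ x : Plane, w ∈ Metric.ball c σ → x ∈ V →
      F x ≤ F (x + w) + ENNReal.ofReal R * ∫⁻ t in Ioc (0 : ℝ) 1, g (x + t • w) := by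
    refine ae_of_all _ fun w => ?_
    by_cases hw : w ∈ Metric.ball c σ
    · filter_upwards [h w hw] with x hx _ using hx
    · exact ae_of_all _ fun x hx => absurd hx hw
  filter_upwards [(Measure.ae_ae_comm hset).1 hae] with x hx hxV
  have hgx : Measurable fun y => g (x + y) := hg.comp (measurable_const_add x)
  have hFx : Measurable fun y => F (x + y) := hF.comp (measurable_const_add x)
  have hmx : Measurable fun w => ∫⁻ t in Ioc (0 : ℝ) 1, g (x + t • w) :=
    hm.comp (measurable_id.prodMk measurable_const)
  calc _ = ∫⁻ w in Metric.ball c σ, F x := by rw [setLIntegral_const, mul_comm]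
    _ ≤ ∫⁻ w in Metric.ball c σ, (F (x + w) +
          ENNReal.ofReal R * ∫⁻ t in Ioc (0 : ℝ) 1, g (x + t • w)) := by
        refine setLIntegral_mono_ae' measurableSet_ball ?_
        filter_upwards [hx] with w hw hwB using hw hwB hxV
    _ = (∫⁻ w in Metric.ball c σ, F (x + w)) +
          ENNReal.ofReal R * ∫⁻ w in Metric.ball c σ, ∫⁻ t in Ioc (0 : ℝ) 1, g (x + t • w) := by
        rw [lintegral_add_left hFx, lintegral_const_mul _ hmx]
    _ ≤ ENNReal.ofReal R * (ENNReal.ofReal R * ∫⁻ y, rieszKernel R y * F (x + y)) +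
          ENNReal.ofReal R * (ENNReal.ofReal R * ∫⁻ y, rieszKernel R y * g (x + y)) := by
        refine add_le_add ?_ (mul_le_mul_right ?_ _)
        · refine (setLIntegral_ball_le hF hR0 hB x).trans (le_mul_of_one_le_left zero_le ?_)
          simpa using hR
        · exact lintegral_segments_le hg hR0 hB x
    _ = _ := by
        simp_rw [mul_add]
        have hkF : Measurable fun y => rieszKernel R y * F (x + y) :=
          (measurable_rieszKernel R).mul hFx
        rw [lintegral_add_left hkF, pow_two,
          ENNReal.ofReal_mul hR0.le]
        ring

/-! ### The fundamental theorem of calculus for weak derivatives -/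

theorem integrable_comp_add_smul {E : Type*} [NormedAddCommGroup E] {W : Plane → E}
    (hW : Integrable W) (hWm : StronglyMeasurable W) (w : Plane) :
    Integrable (fun p : Plane × ℝ => W (p.1 + p.2 • w))
      (volume.prod (volume.restrict (Ioc (0 : ℝ) 1))) := by
  have hm : StronglyMeasurable (fun p : Plane × ℝ => W (p.1 + p.2 • w)) :=
    hWm.comp_measurable (by fun_prop)
  rw [integrable_prod_iff' hm.aestronglyMeasurable]
  refine ⟨ae_of_all _ fun t => hW.comp_add_right (t • w), ?_⟩
  have : ∀ t : ℝ, ∫ x, ‖W (x + t • w)‖ = ∫ x, ‖W x‖ := fun t =>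
    integral_add_right_eq_self (fun x => ‖W x‖) (t • w)
  simp [this]

theorem integral_Ioc_fderiv_sub_smul {φ : Plane → ℝ} (hφ : ContDiff ℝ ∞ φ) (z w : Plane) :
    ∫ t in Ioc (0 : ℝ) 1, fderiv ℝ φ (z - t • w) w = φ z - φ (z - w) := by
  have hd : ∀ t : ℝ, HasDerivAt (fun t : ℝ => φ (z - t • w)) (-(fderiv ℝ φ (z - t • w) w)) t := by
    intro t
    have h1 : HasDerivAt (fun t : ℝ => z - t • w) (-w) t := by
      simpa using ((hasDerivAt_id t).smul_const w).const_sub z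
    have h2 := ((hφ.differentiable (by simp)).differentiableAt (x := z - t • w)).hasFDerivAt
    have h3 := h2.comp_hasDerivAt t h1
    rw [map_neg] at h3
    exact h3
  have hc : Continuous fun t : ℝ => -(fderiv ℝ φ (z - t • w) w) := by
    have := hφ.continuous_fderiv (by simp)
    fun_prop
  have h := intervalIntegral.integral_eq_sub_of_hasDerivAt (fun t _ => hd t)
    (hc.intervalIntegrable 0 1)
  rw [intervalIntegral.integral_of_le zero_le_one, integral_neg] at h
  simp only [one_smul, zero_smul, sub_zero] at h
  linarith

/-- If `W` is the weak derivative on `Ω` of `U` in the direction `w`, then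
`U(x + w) - U(x) = ∫₀¹ W(x + t w) dt` for almost all `x` in an open `V` whose translates by `t w`,
`0 ≤ t ≤ 1`, lie in `Ω`. -/
theorem ae_eq_sub_integral_of_weak_deriv {E : Type*} [NormedAddCommGroup E] [NormedSpace ℝ E]
    [CompleteSpace E] {Ω V : Set Plane} {w : Plane} {U W : Plane → E} (hU : Integrable U)
    (hW : Integrable W) (hWm : StronglyMeasurable W) (hV : IsOpen V)
    (hVΩ : ∀ x ∈ V, ∀ t ∈ Icc (0 : ℝ) 1, x + t • w ∈ Ω)
    (H : ∀ φ : Plane → ℝ, ContDiff ℝ ∞ φ → HasCompactSupport φ → tsupport φ ⊆ Ω →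
      ∫ x, (fderiv ℝ φ x w) • U x = -∫ x, φ x • W x) :
    ∀ᵐ x, x ∈ V → U x = U (x + w) - ∫ t in Ioc (0 : ℝ) 1, W (x + t • w) := by
  have hWi := integrable_comp_add_smul hW hWm w
  have hUw : Integrable fun x => U (x + w) := hU.comp_add_right w
  have hF : Integrable fun x => ∫ t in Ioc (0 : ℝ) 1, W (x + t • w) := hWi.integral_prod_left
  suffices h : ∀ᵐ x, x ∈ V → U x - U (x + w) + ∫ t in Ioc (0 : ℝ) 1, W (x + t • w) = 0 by
    filter_upwards [h] with x hx hxV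
    have := hx hxV
    rw [← sub_eq_zero, ← this]; abel
  have hsum : Integrable fun x => U x - U (x + w) + ∫ t in Ioc (0 : ℝ) 1, W (x + t • w) :=
    (hU.sub hUw).add hF
  refine hV.ae_eq_zero_of_integral_contDiff_smul_eq_zero
    (hsum.locallyIntegrable.locallyIntegrableOn V) fun φ hφ hφc hφV => ?_
  obtain ⟨M, hM⟩ := hφc.exists_bound_of_continuous hφ.continuous
  have hφ' : Continuous (fun x => fderiv ℝ φ x w) :=
    (hφ.continuous_fderiv (by simp)).clm_apply continuous_const
  obtain ⟨M', hM'⟩ := (hφc.fderiv_apply ℝ w).exists_bound_of_continuous hφ'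
  have hbdd : ∀ {f : Plane → E}, Integrable f → Integrable fun x => φ x • f x := fun hf =>
    hf.bdd_smul M hφ.continuous.aestronglyMeasurable (ae_of_all _ hM)
  have hi1 : Integrable (fun p : Plane × ℝ => φ p.1 • W (p.1 + p.2 • w))
      (volume.prod (volume.restrict (Ioc (0 : ℝ) 1))) :=
    hWi.bdd_smul M (hφ.continuous.comp continuous_fst).aestronglyMeasurable
      (ae_of_all _ fun p => hM p.1)
  have hi2 : Integrable (fun p : Plane × ℝ => (fderiv ℝ φ (p.1 - p.2 • w) w) • U p.1)
      (volume.prod (volume.restrict (Ioc (0 : ℝ) 1))) := by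
    have hc : Continuous fun p : Plane × ℝ => fderiv ℝ φ (p.1 - p.2 • w) w :=
      hφ'.comp (by fun_prop)
    exact (hU.comp_fst _).bdd_smul M' hc.aestronglyMeasurable (ae_of_all _ fun p => hM' _)
  have htrans : ∀ t ∈ Ioc (0 : ℝ) 1, ∫ x, φ x • W (x + t • w) =
      -∫ z, (fderiv ℝ φ (z - t • w) w) • U z := by
    intro t ht
    have h1 : ∫ x, φ x • W (x + t • w) = ∫ z, φ (z - t • w) • W z := by
      rw [← integral_add_right_eq_self (fun z => φ (z - t • w) • W z) (t • w)]
      simp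
    have hsub : tsupport (fun z => φ (z - t • w)) ⊆ Ω := by
      have : tsupport (fun z => φ (z - t • w)) ⊆ (fun z => z - t • w) ⁻¹' tsupport φ :=
        tsupport_comp_subset_preimage φ (by fun_prop)
      intro z hz
      have := hVΩ _ (hφV (this hz)) t (Ioc_subset_Icc_self ht)
      simpa using this
    have h2 := H (fun z => φ (z - t • w)) (hφ.comp (by fun_prop))
      (hφc.comp_homeomorph (Homeomorph.subRight (t • w))) hsub
    rw [h1, ← neg_neg (∫ z, φ (z - t • w) • W z), ← h2]
    simp only [sub_eq_add_neg, fderiv_comp_add_right]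
  have h3 : ∫ x, φ x • ∫ t in Ioc (0 : ℝ) 1, W (x + t • w) =
      -∫ z, (φ z - φ (z - w)) • U z := by
    calc _ = ∫ x, ∫ t in Ioc (0 : ℝ) 1, φ x • W (x + t • w) := by
          simp only [integral_smul]
      _ = ∫ t in Ioc (0 : ℝ) 1, ∫ x, φ x • W (x + t • w) := integral_integral_swap hi1
      _ = ∫ t in Ioc (0 : ℝ) 1, -∫ z, (fderiv ℝ φ (z - t • w) w) • U z :=
          setIntegral_congr_fun measurableSet_Ioc htrans
      _ = -∫ z, ∫ t in Ioc (0 : ℝ) 1, (fderiv ℝ φ (z - t • w) w) • U z := by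
          rw [integral_neg, integral_integral_swap (f := fun z (t : ℝ) =>
            (fderiv ℝ φ (z - t • w) w) • U z) hi2]
      _ = _ := by
          simp only [integral_smul_const, integral_Ioc_fderiv_sub_smul hφ]
  have h4 : ∫ x, φ x • U (x + w) = ∫ z, φ (z - w) • U z := by
    rw [← integral_add_right_eq_self (fun z => φ (z - w) • U z) w]
    simp
  have hi4 : Integrable fun z => φ (z - w) • U z :=
    hU.bdd_smul M (hφ.continuous.comp (by fun_prop)).aestronglyMeasurable
      (ae_of_all _ fun z => hM _)
  simp only [smul_add, smul_sub]
  have hi5 : Integrable fun x => φ x • U x - φ x • U (x + w) := (hbdd hU).sub (hbdd hUw)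
  rw [integral_add hi5 (hbdd hF), integral_sub (hbdd hU) (hbdd hUw), h3, h4]
  simp only [sub_smul]
  rw [integral_sub (hbdd hU) hi4]
  abel

theorem ae_enorm_le_of_weak_deriv {E : Type*} [NormedAddCommGroup E] [NormedSpace ℝ E]
    [CompleteSpace E] {Ω V : Set Plane} {w : Plane} {U W : Plane → E} (hU : Integrable U)
    (hW : Integrable W) (hWm : StronglyMeasurable W) (hV : IsOpen V)
    (hVΩ : ∀ x ∈ V, ∀ t ∈ Icc (0 : ℝ) 1, x + t • w ∈ Ω)
    (H : ∀ φ : Plane → ℝ, ContDiff ℝ ∞ φ → HasCompactSupport φ → tsupport φ ⊆ Ω →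
      ∫ x, (fderiv ℝ φ x w) • U x = -∫ x, φ x • W x) :
    ∀ᵐ x, x ∈ V → ‖U x‖ₑ ≤ ‖U (x + w)‖ₑ + ∫⁻ t in Ioc (0 : ℝ) 1, ‖W (x + t • w)‖ₑ := by
  filter_upwards [ae_eq_sub_integral_of_weak_deriv hU hW hWm hV hVΩ H] with x hx hxV
  rw [hx hxV]
  exact (enorm_sub_le).trans (add_le_add le_rfl (enorm_integral_le_lintegral_enorm _))

/-- From the two weak partial derivatives to a weak directional derivative, one test function at a
time. -/
theorem integral_fderiv_smul_of_partials {E : Type*} [NormedAddCommGroup E] [NormedSpace ℝ E]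
    {φ : Plane → ℝ} (hφ : ContDiff ℝ ∞ φ) (hφc : HasCompactSupport φ) {U W Z : Plane → E}
    (hU : Integrable U) (hW : Integrable W) (hZ : Integrable Z)
    (h0 : ∫ x, fderiv ℝ φ x (EuclideanSpace.single 0 1) • U x = -∫ x, φ x • W x)
    (h1 : ∫ x, fderiv ℝ φ x (EuclideanSpace.single 1 1) • U x = -∫ x, φ x • Z x) (w : Plane) :
    ∫ x, fderiv ℝ φ x w • U x = -∫ x, φ x • (w 0 • W x + w 1 • Z x) := by
  have hbdd : ∀ (ψ : Plane → ℝ), Continuous ψ → HasCompactSupport ψ → ∀ {f : Plane → E},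
      Integrable f → ∀ a : ℝ, Integrable fun x => a • (ψ x • f x) := by
    intro ψ hψ hψc f hf a
    obtain ⟨M, hM⟩ := hψc.exists_bound_of_continuous hψ
    exact (hf.bdd_smul M hψ.aestronglyMeasurable (ae_of_all _ hM)).smul a
  have hD : ∀ (e : Plane) (a : ℝ), Integrable fun x => a • (fderiv ℝ φ x e • U x) := fun e =>
    hbdd _ ((hφ.continuous_fderiv (by simp)).clm_apply continuous_const)
      (hφc.fderiv_apply ℝ e) hU
  have hw : w = w 0 • EuclideanSpace.single 0 1 + w 1 • EuclideanSpace.single 1 1 := by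
    ext i; fin_cases i <;> simp
  have hl : ∀ x, fderiv ℝ φ x w • U x =
      w 0 • (fderiv ℝ φ x (EuclideanSpace.single 0 1) • U x) +
        w 1 • (fderiv ℝ φ x (EuclideanSpace.single 1 1) • U x) := by
    intro x
    conv_lhs => rw [hw]
    rw [map_add, map_smul, map_smul, add_smul, smul_assoc, smul_assoc]
  have hr : ∀ x, φ x • (w 0 • W x + w 1 • Z x) = w 0 • (φ x • W x) + w 1 • (φ x • Z x) := by
    intro x
    rw [smul_add, smul_comm (φ x), smul_comm (φ x)]
  simp only [hl, hr]
  rw [integral_add (hD _ _) (hD _ _), integral_add (hbdd φ hφ.continuous hφc hW _)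
    (hbdd φ hφ.continuous hφc hZ _), integral_smul, integral_smul, integral_smul, integral_smul,
    h0, h1]
  module

/-! ### Segments inside a bounded `C¹` domain -/

/-- The interior cone property at a boundary point. With `K` a Lipschitz constant of the graph,
the directions `w` are those near a small upward vector `h ν`, within distance `h / (1 + K)`. -/
theorem exists_ball_segments_subset_of_frontier {Ω : Set Plane} (hΩ : HasC1Boundary Ω)
    {x₀ : Plane} (hx₀ : x₀ ∈ frontier Ω) :
    ∃ (r : ℝ) (c : Plane) (σ : ℝ), 0 < r ∧ 0 < σ ∧ ∀ x ∈ Metric.ball x₀ r ∩ Ω,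
      ∀ w ∈ Metric.ball c σ, ∀ t ∈ Icc (0 : ℝ) 1, x + t • w ∈ Ω := by
  obtain ⟨r, hr, e, γ, hγ, hgraph⟩ := hΩ x₀ hx₀
  obtain ⟨K, T, hT, hK⟩ := (hγ.contDiffAt (x := e x₀ 0)).exists_lipschitzOnWith
  obtain ⟨δ, hδ, hδT⟩ := Metric.mem_nhds_iff.1 hT
  set h : ℝ := min r δ / 4 with hh
  have hh0 : 0 < h := by positivity
  have hhr : 4 * h ≤ r := by rw [hh]; linarith [min_le_left r δ]
  have hhδ : 4 * h ≤ δ := by rw [hh]; linarith [min_le_right r δ]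
  -- The slope condition `K σ ≤ h - σ` keeps `x + t w` above the graph.
  set σ : ℝ := h / (1 + K) with hσ
  have hK0 : (0 : ℝ) ≤ K := K.2
  have hσ0 : 0 < σ := by positivity
  have hσh : σ * (1 + K) = h := by rw [hσ]; field_simp
  have hσle : σ ≤ h := by nlinarith
  set ν : Plane := e.symm (EuclideanSpace.single 1 1) with hν
  have heν : e ν = EuclideanSpace.single 1 1 := e.apply_symm_apply _
  have hνn : ‖ν‖ = 1 := by rw [hν, e.symm.norm_map]; simp
  have hcoord : ∀ (v : Plane) (i : Fin 2), |e v i| ≤ ‖v‖ := fun v i => by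
    rw [← e.norm_map v, ← Real.norm_eq_abs]; exact PiLp.norm_apply_le (e v) i
  refine ⟨2 * h, h • ν, σ, by positivity, hσ0, fun x hx w hw t ht => ?_⟩
  obtain ⟨hxb, hxΩ⟩ := hx
  rw [Metric.mem_ball, dist_eq_norm] at hxb
  have hw' : ‖w - h • ν‖ < σ := by rwa [Metric.mem_ball, dist_eq_norm] at hw
  have hwn : ‖w‖ < 2 * h := by
    calc ‖w‖ = ‖(w - h • ν) + h • ν‖ := by rw [sub_add_cancel]
      _ ≤ ‖w - h • ν‖ + ‖h • ν‖ := norm_add_le _ _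
      _ < 2 * h := by rw [norm_smul, hνn, Real.norm_of_nonneg hh0.le]; linarith
  have htw : ‖t • w‖ < 2 * h := by
    rw [norm_smul, Real.norm_of_nonneg ht.1]
    exact (mul_le_of_le_one_left (norm_nonneg _) ht.2).trans_lt hwn
  have hyb : ‖x + t • w - x₀‖ < 4 * h := by
    calc _ = ‖(x - x₀) + t • w‖ := by congr 1; abel
      _ ≤ _ := norm_add_le _ _
      _ < 4 * h := by linarith
  have hxg : γ (e x 0) < e x 1 := by
    have : x ∈ Ω ∩ Metric.ball x₀ r := ⟨hxΩ, by rw [Metric.mem_ball, dist_eq_norm]; linarith⟩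
    rw [hgraph] at this
    exact this.2
  have hmem : ∀ y : Plane, ‖y - x₀‖ < 4 * h → e y 0 ∈ T := fun y hy => hδT <| by
    rw [Metric.mem_ball, Real.dist_eq]
    have := hcoord (y - x₀) 0
    rw [map_sub, PiLp.sub_apply] at this
    linarith
  have hw0 : |e w 0| ≤ σ := by
    have := hcoord (w - h • ν) 0
    rw [map_sub, map_smul, heν] at this
    simp at this
    linarith
  have hw1 : h - σ < e w 1 := by
    have := hcoord (w - h • ν) 1
    rw [map_sub, map_smul, heν] at this
    simp at this
    linarith [abs_le.1 this]
  have hlip := hK.dist_le_mul _ (hmem _ hyb) _ (hmem x (by linarith))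
  have he0 : e (x + t • w) 0 = e x 0 + t * e w 0 := by simp
  have he1 : e (x + t • w) 1 = e x 1 + t * e w 1 := by simp
  rw [Real.dist_eq, Real.dist_eq, he0, add_sub_cancel_left, abs_mul, abs_of_nonneg ht.1] at hlip
  have hKt : K * (t * |e w 0|) ≤ t * (K * σ) := by
    calc (K : ℝ) * (t * |e w 0|) = t * (K * |e w 0|) := by ring
      _ ≤ t * (K * σ) := by
        have := ht.1
        gcongr
  have ht1 : t * (h - σ) ≤ t * e w 1 := mul_le_mul_of_nonneg_left hw1.le ht.1
  have hfin : x + t • w ∈ Ω ∩ Metric.ball x₀ r := by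
    rw [hgraph]
    refine ⟨by rw [Metric.mem_ball, dist_eq_norm]; linarith, ?_⟩
    rw [he0, he1]
    have hKσ : t * (K * σ) = t * (h - σ) := by rw [← hσh]; ring
    linarith [le_abs_self (γ (e x 0 + t * e w 0) - γ (e x 0))]
  exact hfin.1

/-- The interior cone property at any point of the closure. The ball of directions may contain `0`,
as it does at interior points. -/
theorem exists_ball_segments_subset {Ω : Set Plane} (ho : IsOpen Ω) (hΩ : HasC1Boundary Ω)
    {x₀ : Plane} (hx₀ : x₀ ∈ closure Ω) :
    ∃ (r : ℝ) (c : Plane) (σ : ℝ), 0 < r ∧ 0 < σ ∧ ∀ x ∈ Metric.ball x₀ r ∩ Ω,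
      ∀ w ∈ Metric.ball c σ, ∀ t ∈ Icc (0 : ℝ) 1, x + t • w ∈ Ω := by
  by_cases hx : x₀ ∈ Ω
  · obtain ⟨r, hr, hrΩ⟩ := Metric.isOpen_iff.1 ho x₀ hx
    refine ⟨r / 2, 0, r / 2, by positivity, by positivity, fun x hx w hw t ht => hrΩ ?_⟩
    have hx' := hx.1
    rw [Metric.mem_ball, dist_eq_norm] at hx' ⊢
    rw [mem_ball_zero_iff] at hw
    have htw : ‖t • w‖ ≤ ‖w‖ := by
      rw [norm_smul, Real.norm_of_nonneg ht.1]
      exact mul_le_of_le_one_left (norm_nonneg _) ht.2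
    calc _ = ‖(x - x₀) + t • w‖ := by congr 1; abel
      _ ≤ _ := norm_add_le _ _
      _ < r := by linarith
  · exact exists_ball_segments_subset_of_frontier hΩ ⟨hx₀, by rwa [ho.interior_eq]⟩

/-- A finite form of the uniform interior cone property. -/
theorem IsBoundedC1Domain.exists_finite_cover {Ω : Set Plane} (hΩ : IsBoundedC1Domain Ω) :
    ∃ (s : Finset Plane) (V : Plane → Set Plane) (c : Plane → Plane) (σ : Plane → ℝ),
      (∀ i ∈ s, IsOpen (V i) ∧ 0 < σ i ∧ ∀ x ∈ V i, ∀ w ∈ Metric.ball (c i) (σ i),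
        ∀ t ∈ Icc (0 : ℝ) 1, x + t • w ∈ Ω) ∧ Ω ⊆ ⋃ i ∈ s, V i := by
  have h : ∀ x₀ : Plane, ∃ (r : ℝ) (c : Plane) (σ : ℝ), x₀ ∈ closure Ω → 0 < r ∧ 0 < σ ∧
      ∀ x ∈ Metric.ball x₀ r ∩ Ω, ∀ w ∈ Metric.ball c σ, ∀ t ∈ Icc (0 : ℝ) 1, x + t • w ∈ Ω := by
    intro x₀
    by_cases hx₀ : x₀ ∈ closure Ω
    · obtain ⟨r, c, σ, h⟩ := exists_ball_segments_subset hΩ.isOpen hΩ.c1Boundary hx₀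
      exact ⟨r, c, σ, fun _ => h⟩
    · exact ⟨0, 0, 0, fun h => absurd h hx₀⟩
  choose r c σ h using h
  obtain ⟨s, hs, hcov⟩ := hΩ.isBounded.isCompact_closure.elim_nhds_subcover
    (fun x => Metric.ball x (r x)) fun x hx => Metric.ball_mem_nhds x (h x hx).1
  refine ⟨s, fun i => Metric.ball i (r i) ∩ Ω, c, σ, fun i hi =>
    ⟨Metric.isOpen_ball.inter hΩ.isOpen, (h i (hs i hi)).2⟩, fun x hx => ?_⟩
  have := hcov (subset_closure hx)
  simp only [mem_iUnion] at this ⊢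
  obtain ⟨i, hi, hxi⟩ := this
  exact ⟨i, hi, hxi, hx⟩

/-! ### The Sobolev embedding with its growth in the exponent -/

theorem ofReal_normLp_pow {m : ℕ} {Ω : Set Plane} {f : Plane → EuclideanSpace ℝ (Fin m)} {p : ℕ}
    (hp : p ≠ 0) (hf : MemLp f p (volume.restrict Ω)) :
    ENNReal.ofReal (normLp Ω p f ^ p) = ∫⁻ x in Ω, ‖f x‖ₑ ^ p := by
  rw [normLp, ENNReal.ofReal_pow ENNReal.toReal_nonneg, ENNReal.ofReal_toReal hf.2.ne]
  have := eLpNorm_nnreal_pow_eq_lintegral (f := f) (μ := volume.restrict Ω) (p := (p : NNReal))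
    (by exact_mod_cast hp)
  simpa using this

/-- A strongly measurable representative of `f ∈ L²(Ω)`, extended by zero to the plane. -/
theorem exists_integrable_extension {m : ℕ} {Ω : Set Plane} (ho : IsOpen Ω)
    (hb : Bornology.IsBounded Ω) {f : Plane → EuclideanSpace ℝ (Fin m)}
    (hf : MemLp f 2 (volume.restrict Ω)) :
    ∃ W : Plane → EuclideanSpace ℝ (Fin m), StronglyMeasurable W ∧ Integrable W ∧
      W =ᵐ[volume.restrict Ω] f ∧ (∀ ψ : Plane → ℝ, ∫ x, ψ x • W x = ∫ x in Ω, ψ x • f x) ∧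
      ∫⁻ x, ‖W x‖ₑ ^ 2 = ENNReal.ofReal (normLp Ω 2 f ^ 2) := by
  have hfin : IsFiniteMeasure (volume.restrict Ω) := ⟨by simpa using hb.measure_lt_top⟩
  have hΩ := ho.measurableSet
  have hmk : hf.1.mk f =ᵐ[volume.restrict Ω] f := hf.1.ae_eq_mk.symm
  have hW : Ω.indicator (hf.1.mk f) =ᵐ[volume.restrict Ω] f :=
    (indicator_ae_eq_restrict hΩ).trans hmk
  refine ⟨Ω.indicator (hf.1.mk f), hf.1.stronglyMeasurable_mk.indicator hΩ, ?_, hW, fun ψ => ?_, ?_⟩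
  · rw [integrable_indicator_iff hΩ]
    exact (hf.integrable (by norm_num)).congr hmk.symm
  · have : ∀ x, ψ x • Ω.indicator (hf.1.mk f) x = Ω.indicator (fun x => ψ x • hf.1.mk f x) x :=
      fun x => (indicator_smul_apply Ω ψ (hf.1.mk f) x).symm
    simp only [this]
    rw [integral_indicator hΩ]
    refine integral_congr_ae ?_
    filter_upwards [hmk] with x hx
    rw [hx]
  · have h2 := ofReal_normLp_pow two_ne_zero hf
    rw [Nat.cast_ofNat] at h2
    rw [h2]
    have : ∀ x, ‖Ω.indicator (hf.1.mk f) x‖ₑ ^ 2 = Ω.indicator (fun x => ‖hf.1.mk f x‖ₑ ^ 2) x := by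
      intro x
      by_cases hx : x ∈ Ω <;> simp [hx]
    simp only [this]
    rw [lintegral_indicator hΩ]
    refine lintegral_congr_ae ?_
    filter_upwards [hmk] with x hx
    rw [hx]

theorem normH1_sq {m : ℕ} (Ω : Set Plane) (u : Plane → EuclideanSpace ℝ (Fin m)) :
    normH1 Ω u ^ 2 = normLp Ω 2 u ^ 2 + (normLp Ω 2 (weakPartial Ω 0 u) ^ 2 +
      normLp Ω 2 (weakPartial Ω 1 u) ^ 2) := by
  rw [normH1, Real.sq_sqrt (by positivity), Fin.sum_univ_two]

theorem ENNReal.add_add_sq_le (a b c : ℝ≥0∞) :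
    (a + (b + c)) ^ 2 ≤ 3 * (a ^ 2 + (b ^ 2 + c ^ 2)) := by
  by_cases h : a = ⊤ ∨ b = ⊤ ∨ c = ⊤
  · rcases h with rfl | rfl | rfl <;> simp
  · push Not at h
    obtain ⟨ha, hb, hc⟩ := h
    lift a to NNReal using ha
    lift b to NNReal using hb
    lift c to NNReal using hc
    norm_cast
    rw [← NNReal.coe_le_coe]
    push_cast
    nlinarith [sq_nonneg ((a : ℝ) - b), sq_nonneg ((a : ℝ) - c), sq_nonneg ((b : ℝ) - c)]

/-- The growth estimate on one piece `V` of the cover; the constant `a` depends only on the ball of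
directions. -/
theorem exists_lintegral_pow_le_of_segments {Ω V : Set Plane} (ho : IsOpen Ω)
    (hb : Bornology.IsBounded Ω) (hV : IsOpen V) {c : Plane} {σ : ℝ} (hσ : 0 < σ)
    (hVΩ : ∀ x ∈ V, ∀ w ∈ Metric.ball c σ, ∀ t ∈ Icc (0 : ℝ) 1, x + t • w ∈ Ω) :
    ∃ a : ℝ, 0 ≤ a ∧ ∀ (m : ℕ) (u : Plane → EuclideanSpace ℝ (Fin m)), MemH1 Ω u →
      ∀ n : ℕ, 1 ≤ n → ∫⁻ x in V, ‖u x‖ₑ ^ (2 * n) ≤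
        ENNReal.ofReal (a ^ n * ((n + 1) ^ (n + 1) * (normH1 Ω u ^ 2) ^ n)) := by
  set R : ℝ := max 1 (‖c‖ + σ) with hR
  have hR1 : 1 ≤ R := le_max_left _ _
  have hR0 : 0 < R := by linarith
  have hB : Metric.ball c σ ⊆ Metric.ball 0 R :=
    Metric.ball_subset_ball' (by rw [dist_zero_right, add_comm]; exact le_max_right _ _)
  set v : ℝ := volume.real (Metric.ball (0 : Plane) 1) with hv
  have hv0 : 0 ≤ v := measureReal_nonneg
  set β : ℝ := volume.real (Metric.ball c σ) with hβ
  have hβe : volume (Metric.ball c σ) = ENNReal.ofReal β :=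
    (ofReal_measureReal measure_ball_lt_top.ne).symm
  have hβ0 : 0 < β :=
    ENNReal.toReal_pos (Metric.measure_ball_pos volume c hσ).ne' measure_ball_lt_top.ne
  have hVsub : V ⊆ Ω := fun x hx => by
    simpa using hVΩ x hx c (Metric.mem_ball_self hσ) 0 (by simp)
  refine ⟨(R ^ 2 / β) ^ 2 * (1 + R * v) ^ 2 * 3, by positivity, fun m u hu n hn => ?_⟩
  obtain ⟨U, hUm, hUi, hUu, hUψ, hU2⟩ := exists_integrable_extension ho hb hu.1
  obtain ⟨W, hWm, hWi, -, hWψ, hW2⟩ := exists_integrable_extension ho hb (hu.weakPartial_spec 0).1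
  obtain ⟨Z, hZm, hZi, -, hZψ, hZ2⟩ := exists_integrable_extension ho hb (hu.weakPartial_spec 1).1
  have hseg : ∀ w ∈ Metric.ball c σ, ∀ᵐ x, x ∈ V → ‖U x‖ₑ ≤ ‖U (x + w)‖ₑ +
      ENNReal.ofReal R * ∫⁻ t in Ioc (0 : ℝ) 1, (‖W (x + t • w)‖ₑ + ‖Z (x + t • w)‖ₑ) := by
    intro w hw
    have hwR : ‖w‖ ≤ R := (mem_ball_zero_iff.1 (hB hw)).le
    have hD := ae_enorm_le_of_weak_deriv (Ω := Ω) (w := w) (W := fun x => w 0 • W x + w 1 • Z x)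
      hUi ((hWi.smul (w 0)).add (hZi.smul (w 1)))
      ((hWm.const_smul (w 0)).add (hZm.const_smul (w 1))) hV (fun x hx => hVΩ x hx w hw)
      fun φ hφ hφc hφΩ =>
        integral_fderiv_smul_of_partials hφ hφc hUi hWi hZi
          (by rw [hUψ, hWψ]; exact (hu.weakPartial_spec 0).2.2.2 φ hφ hφc hφΩ)
          (by rw [hUψ, hZψ]; exact (hu.weakPartial_spec 1).2.2.2 φ hφ hφc hφΩ) w
    filter_upwards [hD] with x hx hxV
    refine (hx hxV).trans ?_
    gcongr
    have hm : Measurable fun t : ℝ => ‖W (x + t • w)‖ₑ + ‖Z (x + t • w)‖ₑ :=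
      (hWm.enorm.comp (by fun_prop)).add (hZm.enorm.comp (by fun_prop))
    rw [← lintegral_const_mul _ hm]
    refine lintegral_mono fun t => ?_
    have hwi : ∀ i, ‖w i‖ₑ ≤ ENNReal.ofReal R := fun i => by
      rw [← ofReal_norm]
      exact ENNReal.ofReal_le_ofReal ((PiLp.norm_apply_le w i).trans hwR)
    refine (enorm_add_le _ _).trans ?_
    rw [enorm_smul, enorm_smul, mul_add]
    gcongr
    · exact hwi 0
    · exact hwi 1
  have hgm : Measurable fun x => ‖W x‖ₑ + ‖Z x‖ₑ := hWm.enorm.add hZm.enorm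
  have hGm : Measurable fun x => ‖U x‖ₑ + (‖W x‖ₑ + ‖Z x‖ₑ) := hUm.enorm.add hgm
  have hpt := measure_ball_mul_le_lintegral_rieszKernel hUm.enorm hgm hV.measurableSet hR1 hB hseg
  have hconv := lintegral_pow_rieszKernel_le hR1 hGm hn
  have hG2 : ∫⁻ x, (‖U x‖ₑ + (‖W x‖ₑ + ‖Z x‖ₑ)) ^ 2 ≤ ENNReal.ofReal (3 * normH1 Ω u ^ 2) := by
    calc _ ≤ ∫⁻ x, 3 * (‖U x‖ₑ ^ 2 + (‖W x‖ₑ ^ 2 + ‖Z x‖ₑ ^ 2)) :=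
          lintegral_mono fun x => ENNReal.add_add_sq_le _ _ _
      _ = 3 * ((∫⁻ x, ‖U x‖ₑ ^ 2) + ((∫⁻ x, ‖W x‖ₑ ^ 2) + ∫⁻ x, ‖Z x‖ₑ ^ 2)) := by
          have hU' := hUm.enorm.pow_const 2
          have hW' := hWm.enorm.pow_const 2
          rw [lintegral_const_mul' _ _ (by norm_num), lintegral_add_left hU',
            lintegral_add_left hW']
      _ = _ := by
          rw [hU2, hW2, hZ2, normH1_sq, ENNReal.ofReal_mul (by norm_num),
            ENNReal.ofReal_add (by positivity) (by positivity),
            ENNReal.ofReal_add (by positivity) (by positivity)]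
          norm_num
  have hptu : ∀ᵐ x ∂(volume.restrict V), ‖u x‖ₑ ^ (2 * n) ≤ ENNReal.ofReal (R ^ 2 / β) ^ (2 * n) *
      (∫⁻ y, rieszKernel R y * (‖U (x + y)‖ₑ + (‖W (x + y)‖ₑ + ‖Z (x + y)‖ₑ))) ^ (2 * n) := by
    filter_upwards [ae_restrict_of_ae hpt, ae_restrict_mem hV.measurableSet,
      ae_restrict_of_ae_restrict_of_subset hVsub hUu] with x hx hxV hxu
    rw [← hxu, ← mul_pow]
    refine pow_le_pow_left' ?_ _
    have h := hx hxV
    rw [hβe, mul_comm] at h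
    rw [ENNReal.ofReal_div_of_pos hβ0, ← ENNReal.mul_div_right_comm]
    exact (ENNReal.le_div_iff_mul_le (Or.inl (by simpa using hβ0))
      (Or.inl ENNReal.ofReal_ne_top)).2 h
  set N2 := normH1 Ω u ^ 2 with hN2
  have hN20 : 0 ≤ N2 := sq_nonneg _
  calc ∫⁻ x in V, ‖u x‖ₑ ^ (2 * n) ≤ ∫⁻ x in V, ENNReal.ofReal (R ^ 2 / β) ^ (2 * n) *
        (∫⁻ y, rieszKernel R y * (‖U (x + y)‖ₑ + (‖W (x + y)‖ₑ + ‖Z (x + y)‖ₑ))) ^ (2 * n) :=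
        lintegral_mono_ae hptu
    _ ≤ ENNReal.ofReal (R ^ 2 / β) ^ (2 * n) * ∫⁻ x,
        (∫⁻ y, rieszKernel R y * (‖U (x + y)‖ₑ + (‖W (x + y)‖ₑ + ‖Z (x + y)‖ₑ))) ^ (2 * n) := by
        rw [lintegral_const_mul' _ _ (ENNReal.pow_ne_top ENNReal.ofReal_ne_top)]
        gcongr
        exact Measure.restrict_le_self
    _ ≤ ENNReal.ofReal (R ^ 2 / β) ^ (2 * n) * (ENNReal.ofReal (R * v * (n + 1)) ^ (n + 1) *
        ENNReal.ofReal (3 * N2) ^ n) := by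
        gcongr
        exact hconv.trans (by gcongr)
    _ = ENNReal.ofReal ((R ^ 2 / β) ^ (2 * n) * ((R * v * (n + 1)) ^ (n + 1) * (3 * N2) ^ n)) := by
        rw [← ENNReal.ofReal_pow (by positivity), ← ENNReal.ofReal_pow (by positivity),
          ← ENNReal.ofReal_pow (by positivity), ← ENNReal.ofReal_mul (by positivity),
          ← ENNReal.ofReal_mul (by positivity)]
    _ ≤ _ := by
        refine ENNReal.ofReal_le_ofReal ?_
        have h1 : (R * v) ^ (n + 1) ≤ ((1 + R * v) ^ 2) ^ n := by
          have hRv : 0 ≤ R * v := by positivity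
          rw [← pow_mul]
          calc (R * v) ^ (n + 1) ≤ (1 + R * v) ^ (n + 1) := by gcongr; linarith
            _ ≤ (1 + R * v) ^ (2 * n) := pow_le_pow_right₀ (by linarith) (by omega)
        calc _ = (R * v) ^ (n + 1) *
              (((R ^ 2 / β) ^ 2) ^ n * (3 ^ n * ((n + 1) ^ (n + 1) * N2 ^ n))) := by
              rw [mul_pow (R * v), mul_pow 3, pow_mul]; ring
          _ ≤ ((1 + R * v) ^ 2) ^ n *
              (((R ^ 2 / β) ^ 2) ^ n * (3 ^ n * ((n + 1) ^ (n + 1) * N2 ^ n))) := by gcongr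
          _ = _ := by rw [mul_pow _ (3 : ℝ), mul_pow ((R ^ 2 / β) ^ 2)]; ring

/-- The Sobolev embedding of `H¹(Ω)` into `L^{2n}(Ω)`, with a constant that grows like `√n`,
uniformly in the number of components. -/
theorem IsBoundedC1Domain.exists_lintegral_pow_le {Ω : Set Plane} (hΩ : IsBoundedC1Domain Ω) :
    ∃ A : ℝ, 1 ≤ A ∧ ∀ (m : ℕ) (u : Plane → EuclideanSpace ℝ (Fin m)), MemH1 Ω u →
      ∀ n : ℕ, 1 ≤ n → ∫⁻ x in Ω, ‖u x‖ₑ ^ (2 * n) ≤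
        ENNReal.ofReal (A ^ n * ((n + 1) ^ (n + 1) * (normH1 Ω u ^ 2) ^ n)) := by
  obtain ⟨s, V, c, σ, hs, hcov⟩ := hΩ.exists_finite_cover
  have h : ∀ i, ∃ a : ℝ, 0 ≤ a ∧ (i ∈ s → ∀ (m : ℕ) (u : Plane → EuclideanSpace ℝ (Fin m)),
      MemH1 Ω u → ∀ n : ℕ, 1 ≤ n → ∫⁻ x in V i, ‖u x‖ₑ ^ (2 * n) ≤
        ENNReal.ofReal (a ^ n * ((n + 1) ^ (n + 1) * (normH1 Ω u ^ 2) ^ n))) := by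
    intro i
    by_cases hi : i ∈ s
    · obtain ⟨hVo, hσ, hseg⟩ := hs i hi
      obtain ⟨a, ha, h⟩ := exists_lintegral_pow_le_of_segments hΩ.isOpen hΩ.isBounded hVo hσ hseg
      exact ⟨a, ha, fun _ => h⟩
    · exact ⟨0, le_rfl, fun h => absurd h hi⟩
  choose a ha h using h
  have hsum0 : 0 ≤ ∑ i ∈ s, a i := Finset.sum_nonneg fun i _ => ha i
  refine ⟨1 + ∑ i ∈ s, a i, by linarith, fun m u hu n hn => ?_⟩
  set T : ℝ := (n + 1) ^ (n + 1) * (normH1 Ω u ^ 2) ^ n with hT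
  have hT0 : 0 ≤ T := by positivity
  calc _ ≤ ∫⁻ x in ⋃ i ∈ s, V i, ‖u x‖ₑ ^ (2 * n) := lintegral_mono_set hcov
    _ ≤ ∑ i ∈ s, ∫⁻ x in V i, ‖u x‖ₑ ^ (2 * n) := by
        rw [← Finset.sum_coe_sort, ← tsum_fintype (L := .unconditional _)]
        rw [show ⋃ i ∈ s, V i = ⋃ i : s, V i by ext; simp]
        exact lintegral_iUnion_le (fun i : s => V i) _
    _ ≤ ∑ i ∈ s, ENNReal.ofReal (a i ^ n * T) := Finset.sum_le_sum fun i hi => h i hi m u hu n hn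
    _ = ENNReal.ofReal (∑ i ∈ s, a i ^ n * T) :=
        (ENNReal.ofReal_sum_of_nonneg fun i _ => mul_nonneg (pow_nonneg (ha i) n) hT0).symm
    _ ≤ _ := by
        refine ENNReal.ofReal_le_ofReal ?_
        rw [← Finset.sum_mul]
        gcongr
        obtain ⟨k, rfl⟩ := Nat.exists_eq_add_of_le' hn
        calc ∑ i ∈ s, a i ^ (k + 1) ≤ ∑ i ∈ s, (∑ j ∈ s, a j) ^ k * a i := by
              refine Finset.sum_le_sum fun i hi => ?_
              rw [pow_succ]
              have := Finset.single_le_sum (fun j _ => ha j) hi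
              have := ha i
              gcongr
          _ = (∑ j ∈ s, a j) ^ (k + 1) := by rw [← Finset.mul_sum, pow_succ]
          _ ≤ _ := by gcongr; linarith

/-! ### Interpolation and the choice of the exponent -/

/-- Interpolation of `L⁴` between `L²` and `L^{2q+2}`, raised to the power `4q`. -/
theorem lintegral_pow_four_pow_le {α : Type*} [MeasurableSpace α] {μ : Measure α} {f : α → ℝ≥0∞}
    (hf : AEMeasurable f μ) {q : ℕ} (hq : 1 ≤ q) :
    (∫⁻ x, f x ^ 4 ∂μ) ^ q ≤ (∫⁻ x, f x ^ 2 ∂μ) ^ (q - 1) * ∫⁻ x, f x ^ (2 * (q + 1)) ∂μ := by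
  have hq1 : (1 : ℝ) ≤ q := by exact_mod_cast hq
  have hq0 : (0 : ℝ) < q := by linarith
  have ha : (0 : ℝ) ≤ (q - 1) / q := div_nonneg (by linarith) hq0.le
  have hb : (0 : ℝ) ≤ 1 / q := by positivity
  have key := ENNReal.lintegral_mul_norm_pow_le (μ := μ) (hf.pow_const 2)
    (hf.pow_const (2 * (q + 1))) ha hb (by field_simp; ring)
  have hint : ∀ x, (f x ^ 2) ^ (((q : ℝ) - 1) / q) * (f x ^ (2 * (q + 1))) ^ (1 / (q : ℝ)) =
      f x ^ 4 := by
    intro x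
    rw [← ENNReal.rpow_natCast, ← ENNReal.rpow_natCast, ← ENNReal.rpow_natCast, ← ENNReal.rpow_mul,
      ← ENNReal.rpow_mul, ← ENNReal.rpow_add_of_nonneg _ _ (by positivity) (by positivity)]
    congr 1
    push_cast
    field_simp
    ring
  simp only [hint] at key
  calc _ ≤ _ := pow_le_pow_left' key q
    _ = _ := by
      rw [mul_pow, ← ENNReal.rpow_natCast, ← ENNReal.rpow_natCast, ← ENNReal.rpow_mul,
        ← ENNReal.rpow_mul, div_mul_cancel₀ _ hq0.ne', div_mul_cancel₀ _ hq0.ne', ENNReal.rpow_one,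
        ← ENNReal.rpow_natCast, Nat.cast_sub hq, Nat.cast_one]

/-- Optimization over `q`: with `L = log (2 + N²)` and `q = ⌈L⌉` one has `N² ≤ e^q`, so that the
`q`-th root of the right-hand side is at most a constant times `(1 + a)² K² L N²`. -/
theorem sq_le_of_pow_ceil_log_le {a b K N : ℝ} (ha : 0 ≤ a) (hK : 1 ≤ K) (hN : 0 ≤ N)
    (h : ∀ q : ℕ, 1 ≤ q → (b ^ 4) ^ q ≤
      (a ^ 2) ^ (q - 1) * (K ^ (q + 1) * ((q : ℝ) + 2) ^ (q + 2) * (N ^ 2) ^ (q + 1))) :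
    b ^ 2 ≤ 14 * K * (1 + a) * N * Real.log (2 + N ^ 2) ^ (1 / 2 : ℝ) := by
  set L := Real.log (2 + N ^ 2) with hL
  have hL2 : (1 / 2 : ℝ) ≤ L := by
    have h1 : Real.log 2 ≤ L := Real.log_le_log (by norm_num) (by nlinarith)
    linarith [Real.log_two_gt_d9]
  have hL0 : 0 ≤ L := by linarith
  set q := ⌈L⌉₊ with hq
  have hqL : L ≤ q := Nat.le_ceil L
  have hqL' : (q : ℝ) < L + 1 := Nat.ceil_lt_add_one hL0
  have hq1 : 1 ≤ q := Nat.one_le_iff_ne_zero.2 fun h0 => by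
    rw [h0, Nat.cast_zero] at hqL; linarith
  have hNexp : N ^ 2 ≤ Real.exp 1 ^ q := by
    calc N ^ 2 ≤ 2 + N ^ 2 := by linarith
      _ = Real.exp L := (Real.exp_log (by positivity)).symm
      _ ≤ Real.exp q := Real.exp_le_exp.2 hqL
      _ = Real.exp 1 ^ q := by rw [← Real.exp_nat_mul, mul_one]
  have h3 : ∀ k : ℕ, 1 ≤ k → (k : ℝ) + 2 ≤ 3 ^ k := by
    intro k hk
    induction k, hk using Nat.le_induction with
    | base => norm_num
    | succ k _ ih => rw [pow_succ]; push_cast; nlinarith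
  -- The root `(q + 2)^{2/q}` is bounded by `9`.
  have h9 : ((q : ℝ) + 2) ^ 2 ≤ 9 ^ q := by
    calc ((q : ℝ) + 2) ^ 2 ≤ (3 ^ q) ^ 2 := by gcongr; exact h3 q hq1
      _ = 9 ^ q := by rw [← pow_mul, mul_comm, pow_mul]; norm_num
  have hroot : b ^ 4 ≤ (1 + a) ^ 2 * (K ^ 2 * (9 * ((q : ℝ) + 2)) * (Real.exp 1 * N ^ 2)) := by
    refine le_of_pow_le_pow_left₀ (n := q) (by omega) (by positivity) ((h q hq1).trans ?_)
    rw [mul_pow, mul_pow _ (Real.exp 1 * N ^ 2), mul_pow (K ^ 2), mul_pow 9, mul_pow (Real.exp 1)]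
    gcongr ?_ * (?_ * ?_ * ?_)
    -- The exponent `q - 1` of `a²` is raised to `q` by passing to `1 + a ≥ 1`.
    · calc (a ^ 2) ^ (q - 1) ≤ ((1 + a) ^ 2) ^ (q - 1) := by gcongr; linarith
        _ ≤ ((1 + a) ^ 2) ^ q :=
          pow_le_pow_right₀ (one_le_pow₀ (by linarith)) (Nat.sub_le q 1)
    · rw [← pow_mul]
      exact pow_le_pow_right₀ hK (by omega)
    · rw [pow_add, mul_comm]
      gcongr
    · rw [pow_succ, mul_comm]
      gcongr
  have hq7 : (q : ℝ) + 2 ≤ 7 * L := by linarith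
  have he : Real.exp 1 ≤ 2.72 := by linarith [Real.exp_one_lt_d9]
  rw [← Real.sqrt_eq_rpow]
  refine le_of_pow_le_pow_left₀ two_ne_zero (by positivity) ?_
  have hs : Real.sqrt L ^ 2 = L := Real.sq_sqrt hL0
  calc (b ^ 2) ^ 2 = b ^ 4 := by ring
    _ ≤ _ := hroot
    _ ≤ (1 + a) ^ 2 * (K ^ 2 * (9 * (7 * L)) * (2.72 * N ^ 2)) := by gcongr
    _ = 171.36 * ((1 + a) ^ 2 * K ^ 2 * N ^ 2 * L) := by ring
    _ ≤ 196 * ((1 + a) ^ 2 * K ^ 2 * N ^ 2 * L) := by gcongr; norm_num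
    _ = (14 * K * (1 + a) * N * Real.sqrt L) ^ 2 := by rw [mul_pow, hs]; ring

theorem lemma2p10 (Ω : Set Plane) (hΩ : IsBoundedC1Domain Ω) (ρbar : ℝ) :
    ∃ C : ℝ, 0 < C ∧
      ∀ (m : ℕ) (ρ : Plane → ℝ) (u : Plane → EuclideanSpace ℝ (Fin m)),
        MemLp ρ ∞ (volume.restrict Ω) →
        (∀ᵐ x ∂(volume.restrict Ω), 0 ≤ ρ x ∧ ρ x ≤ ρbar) →
        MemH1 Ω u →
        MemLp (fun x => Real.sqrt (ρ x) • u x) 4 (volume.restrict Ω) ∧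
          normLp Ω 4 (fun x => Real.sqrt (ρ x) • u x) ^ 2 ≤
            C * (1 + normLp Ω 2 (fun x => Real.sqrt (ρ x) • u x)) * normH1 Ω u *
              Real.log (2 + normH1 Ω u ^ 2) ^ (1 / 2 : ℝ) := by
  obtain ⟨A, hA, hpow⟩ := hΩ.exists_lintegral_pow_le
  set P : ℝ := max 1 ρbar with hP
  have hP1 : 1 ≤ P := le_max_left _ _
  refine ⟨14 * (P * A), by positivity, fun m ρ u hρ hρb hu => ?_⟩
  set g : Plane → EuclideanSpace ℝ (Fin m) := fun x => Real.sqrt (ρ x) • u x with hg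
  have hgm : AEStronglyMeasurable g (volume.restrict Ω) :=
    (Real.continuous_sqrt.comp_aestronglyMeasurable hρ.1).smul hu.1.1
  have hgu : ∀ᵐ x ∂(volume.restrict Ω), ‖g x‖ₑ ^ 2 ≤ ENNReal.ofReal P * ‖u x‖ₑ ^ 2 := by
    filter_upwards [hρb] with x hx
    simp only [hg]
    rw [enorm_smul, mul_pow, ← ofReal_norm (Real.sqrt (ρ x)),
      Real.norm_of_nonneg (Real.sqrt_nonneg _), ← ENNReal.ofReal_pow (Real.sqrt_nonneg _), Real.sq_sqrt hx.1]
    gcongr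
    exact hx.2.trans (le_max_right _ _)
  have hgpow : ∀ n : ℕ, 1 ≤ n → ∫⁻ x in Ω, ‖g x‖ₑ ^ (2 * n) ≤
      ENNReal.ofReal ((P * A) ^ n * ((n + 1) ^ (n + 1) * (normH1 Ω u ^ 2) ^ n)) := by
    intro n hn
    calc _ ≤ ∫⁻ x in Ω, ENNReal.ofReal P ^ n * ‖u x‖ₑ ^ (2 * n) := by
          refine lintegral_mono_ae ?_
          filter_upwards [hgu] with x hx
          rw [pow_mul, pow_mul, ← mul_pow]
          exact pow_le_pow_left' hx n
      _ ≤ ENNReal.ofReal P ^ n *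
          ENNReal.ofReal (A ^ n * ((n + 1) ^ (n + 1) * (normH1 Ω u ^ 2) ^ n)) := by
          rw [lintegral_const_mul' _ _ (ENNReal.pow_ne_top ENNReal.ofReal_ne_top)]
          gcongr
          exact hpow m u hu n hn
      _ = _ := by
          rw [← ENNReal.ofReal_pow (by positivity), ← ENNReal.ofReal_mul (by positivity), mul_pow,
            mul_assoc]
  have hmem : ∀ n : ℕ, 1 ≤ n → MemLp g (2 * n : ℕ) (volume.restrict Ω) := by
    intro n hn
    have hn0 : ((2 * n : ℕ) : ℝ≥0∞) ≠ 0 := by exact_mod_cast (by omega : 2 * n ≠ 0)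
    refine ⟨hgm, (eLpNorm_lt_top_iff_lintegral_rpow_enorm_lt_top hn0
      (ENNReal.natCast_ne_top _)).2 ?_⟩
    simp only [ENNReal.toReal_natCast, ENNReal.rpow_natCast]
    exact (hgpow n hn).trans_lt ENNReal.ofReal_lt_top
  have h4 : MemLp g 4 (volume.restrict Ω) := by simpa using hmem 2 (by norm_num)
  have h2 : MemLp g 2 (volume.restrict Ω) := by simpa using hmem 1 le_rfl
  have e4 : ENNReal.ofReal (normLp Ω 4 g ^ 4) = ∫⁻ x in Ω, ‖g x‖ₑ ^ 4 :=
    ofReal_normLp_pow (p := 4) (by norm_num) h4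
  have e2 : ENNReal.ofReal (normLp Ω 2 g ^ 2) = ∫⁻ x in Ω, ‖g x‖ₑ ^ 2 :=
    ofReal_normLp_pow (p := 2) (by norm_num) h2
  refine ⟨h4, sq_le_of_pow_ceil_log_le ENNReal.toReal_nonneg
    (one_le_mul_of_one_le_of_one_le hP1 hA) (Real.sqrt_nonneg _) fun q hq => ?_⟩
  have hH := (lintegral_pow_four_pow_le hgm.enorm hq).trans
    (mul_le_mul_right (hgpow (q + 1) (by omega)) _)
  have hA0 : 0 ≤ A := by linarith
  have hP0 : 0 ≤ P := by linarith
  rw [← e4, ← e2, ← ENNReal.ofReal_pow (by positivity), ← ENNReal.ofReal_pow (by positivity),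
    ← ENNReal.ofReal_mul (by positivity), ENNReal.ofReal_le_ofReal_iff (by positivity)] at hH
  refine hH.trans (le_of_eq ?_)
  push_cast
  ring
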